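/- Let $n,k\ge 0$ be integers. Let $Cl_{n+1}$ be the real Clifford algebra generated by $\mathbb{R}^{n+1}$ with $x^2=-\|x\|^2$, let $e_1,\dots,e_{n+1}$ be the standard basis of $\mathbb{R}^{n+1}$, and let $\mathbb{R}^n=\mathrm{span}(e_1,\dots,e_n)$. For a linear subspace $W\subseteq\mathbb{R}^{n+1}$ with orthonormal basis $(b_i)$ let $\mathcal{M}_k(W)$ be the space of $Cl_{n+1}$-valued polynomials $p$ on $W$, homogeneous of degree $k$, with $\sum_i b_i\,\partial_{b_i}p=0$ ($\mathcal{M}_{-1}(W)=0$), let $\mathcal{H}_k(W)$ be the space of $Cl_{n+1}$-valued harmonic polynomials on $W$, homogeneous of degree $k$, and let $P_{k,W}:\mathcal{H}_k(W)=\mathcal{M}_k(W)\oplus w\,\mathcal{M}_{k-1}(W)\to\mathcal{M}_k(W)$ be the projection of the Almansi–Fischer decomposition. Let $D_x=\sum_{j=1}^n e_j\,\partial/\partial x_j$ be the Dirac operator on $\mathbb{R}^n$ and $D_s=x_s\bigl(\sum_{1\le i<j\le n+1}e_ie_j(x_i\partial_{x_j}-x_j\partial_{x_i})+\tfrac n2\bigr)$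 the spherical Dirac operator on the unit sphere $\mathbb{S}^n\subset\mathbb{R}^{n+1}$. Put $R_k=P_{k,\mathbb{R}^n}D_x$, and $R_k^S=P_{k,W}D_s$ for functions $F(x_s,w)$ near a point of $\mathbb{S}^n$, where $D_s$ acts in $x_s$ with $w\in\mathbb{R}^{n+1}$ fixed and $P_{k,W}$ acts in $w\in W$. Let $U\subseteq\mathbb{R}^n$ be open and let $f:U\times\mathbb{R}^n\to Cl_{n+1}$ be differentiable with $f(x,\cdot)\in\mathcal{M}_k(\mathbb{R}^n)$ for every $x\in U$; extend $f(x,\cdot)$ to $\mathbb{R}^{n+1}$ so that it does not depend on the $e_{n+1}$-coordinate. For $x_s\in\mathbb{S}^n\setminus\{e_{n+1}\}$ let $x=C^{-1}(x_s)=(-e_{n+1}x_s+1)(x_s-e_{n+1})^{-1}\in\mathbb{R}^n$ (inverse Cayley transformation), and $$a=\frac{x_s-e_{n+1}}{\|x_s-e_{n+1}\|},\quad J(C^{-1},x_s)=\frac{x_s-e_{n+1}}{\|x_s-e_{n+1}\|^{n}},\quad J_{-1}(C^{-1},x_s)=\frac{x_s-e_{n+1}}{\|x_s-e_{n+1}\|^{n+2}}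 .$$ Suppose that $C^{-1}(x_s)\in U$ and put $W=a^{-1}\mathbb{R}^n\tilde a^{-1}=\{w\in\mathbb{R}^{n+1}: aw\tilde a\in\mathbb{R}^n\}$, where $\tilde a=a$ is the reversion of $a$, and $F(y_s,w)=J(C^{-1},y_s)\,f\bigl(C^{-1}(y_s),\,a(y_s)\,w\,\widetilde{a(y_s)}\bigr)$, where $a(y_s)=(y_s-e_{n+1})/\|y_s-e_{n+1}\|$. Then $F(\cdot,w)$ is differentiable at $x_s$ for every $w\in\mathbb{R}^{n+1}$, $F(x_s,\cdot)|_W\in\mathcal{M}_k(W)$, $D_xf(x,\cdot)\in\mathcal{H}_k(\mathbb{R}^n)$ and $D_sF(x_s,\cdot)|_W\in\mathcal{H}_k(W)$, both of these functions have Almansi–Fischer decompositions (so that $R_kf$ and $R_k^SF$ are their monogenic components), and for every $w\in W$, with $u=aw\tilde a$, $$-2\,J_{-1}(C^{-1},x_s)\,R_kf(x,u)=R_k^S\bigl[J(C^{-1},x_s)\,f(C^{-1}(x_s),aw\tilde a)\bigr].$$ -/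

import Mathlib

open scoped InnerProductSpace Laplacian

noncomputable section

namespace RaritaSchwinger

/-- Euclidean space `ℝ^{n+1}`. -/
abbrev E (n : ℕ) : Type := EuclideanSpace ℝ (Fin (n + 1))

/-- The quadratic form `x ↦ -‖x‖²` on `ℝ^{n+1}`. -/
def Q (n : ℕ) : QuadraticForm ℝ (E n) :=
  -(LinearMap.BilinMap.toQuadraticMap (innerₗ (E n)))

theorem Q_apply (n : ℕ) (x : E n) : Q n x = -‖x‖ ^ 2 := by
  simp [Q]

/-- The Clifford algebra `Cl_{n+1}`, generated by `ℝ^{n+1}` subject to `x² = -‖x‖²`. -/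
abbrev Cl (n : ℕ) : Type := CliffordAlgebra (Q n)

/-- The inclusion of `ℝ^{n+1}` in `Cl_{n+1}`. -/
abbrev ιv {n : ℕ} (x : E n) : Cl n := CliffordAlgebra.ι (Q n) x

/-- The standard orthonormal basis of `ℝ^{n+1}`; index `j : Fin (n + 1)` is the vector usually
written `e_{j+1}`. -/
def e {n : ℕ} (j : Fin (n + 1)) : E n := EuclideanSpace.single j 1

/-- The last basis vector, `e_{n+1}`. -/
def eLast (n : ℕ) : E n := e (Fin.last n)

/-- Coordinates on `Cl_{n+1}` with respect to the basis `(e_A)` indexed by the subsets `A`. -/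
def coords (n : ℕ) : Cl n ≃ₗ[ℝ] EuclideanSpace ℝ (Finset (Fin (n + 1))) :=
  (CliffordAlgebra.equivExterior (Q n)).trans
    (((EuclideanSpace.basisFun (Fin (n + 1)) ℝ).toBasis.ExteriorAlgebra).equivFun.trans
      (WithLp.linearEquiv 2 ℝ (Finset (Fin (n + 1)) → ℝ)).symm)

/-- The Euclidean norm of the coordinates. It serves to differentiate `Cl_{n+1}`-valued functions;
as `Cl_{n+1}` is finite dimensional, derivatives do not depend on the choice of a norm. -/
instance (n : ℕ) : NormedAddCommGroup (Cl n) :=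
  NormedAddCommGroup.induced _ _ (coords n) (coords n).injective

instance (n : ℕ) : NormedSpace ℝ (Cl n) :=
  NormedSpace.induced ℝ (Cl n) _ (coords n)

/-- `ℝ^n`, the span of `e_1, …, e_n` in `ℝ^{n+1}`. -/
def Rn (n : ℕ) : Submodule ℝ (E n) :=
  Submodule.span ℝ (Set.range fun j : Fin n => (e j.castSucc : E n))

/-- The orthogonal projection of `ℝ^{n+1}` onto `ℝ^n`. -/
def toRn (n : ℕ) : E n →L[ℝ] Rn n := (Rn n).orthogonalProjectionOnto

section Polynomials

variable {n : ℕ} {W : Submodule ℝ (E n)}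

/-- `Cl_{n+1}`-valued polynomials on `W`, homogeneous of degree `k`. -/
def IsHomPoly (k : ℕ) (p : W → Cl n) : Prop :=
  ∃ M : MultilinearMap ℝ (fun _ : Fin k => W) (Cl n), ∀ w, p w = M fun _ => w

/-- The Dirac operator of a subspace `W` of `ℝ^{n+1}`: extend `p` trivially to `ℝ^{n+1}` (constant
in the directions orthogonal to `W`), apply `∑ j, e_j ∂/∂x_j` and restrict to `W`. For `W = ℝ^n`
this is `∑_{j ≤ n} e_j ∂/∂x_j`. -/
def dirac (p : W → Cl n) (w : W) : Cl n :=
  ∑ j : Fin (n + 1), ιv (e j) * fderiv ℝ p w (W.orthogonalProjectionOnto (e j))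

/-- `𝓜_k(W)`: left monogenic polynomials on `W`, homogeneous of degree `k`. -/
def IsMonogenic (k : ℕ) (p : W → Cl n) : Prop :=
  IsHomPoly k p ∧ ∀ w, dirac p w = 0

/-- `𝓗_k(W)`: harmonic polynomials on `W`, homogeneous of degree `k`. -/
def IsHarmonic (k : ℕ) (h : W → Cl n) : Prop :=
  IsHomPoly k h ∧ ∀ w, Δ h w = 0

/-- `𝓜_{k-1}(W)`, with the convention `𝓜_{-1}(W) = 0`. -/
def IsMonogenicPred : ℕ → (W → Cl n) → Prop
  | 0, q => ∀ w, q w = 0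
  | k + 1, q => IsMonogenic k q

/-- `p` is the component in `𝓜_k` of `h`, with respect to the Almansi-Fischer decomposition
`𝓗_k = 𝓜_k ⊕ w 𝓜_{k-1}`. -/
def IsMonogenicPart (k : ℕ) (h p : W → Cl n) : Prop :=
  IsMonogenic k p ∧ ∃ q : W → Cl n, IsMonogenicPred k q ∧ ∀ w : W, h w = p w + ιv (w : E n) * q w

open Classical in
/-- The left projection `P_k : 𝓗_k = 𝓜_k ⊕ w 𝓜_{k-1} → 𝓜_k`. -/
def P (k : ℕ) (h : W → Cl n) : W → Cl n :=
  if H : ∃ p, IsMonogenicPart k h p then H.choose else 0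

end Polynomials

/-- `D_x f(x, ·)`, the Dirac operator on `ℝ^n` in the first variable. -/
def diracX {n : ℕ} (f : Rn n → Rn n → Cl n) (x u : Rn n) : Cl n :=
  dirac (fun y => f y u) x

/-- The Rarita-Schwinger operator `R_k = P_k D_x` on `ℝ^n`. -/
def R {n : ℕ} (k : ℕ) (f : Rn n → Rn n → Cl n) (x : Rn n) : Rn n → Cl n :=
  P k (diracX f x)

/-- The partial derivative `∂/∂x_j` at `x ∈ 𝕊^n` of the extension of `g`, from `𝕊^n` to
`ℝ^{n+1} ∖ {0}`, that is homogeneous of degree `0`. -/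
def spherePartial {n : ℕ} (g : E n → Cl n) (x : E n) (j : Fin (n + 1)) : Cl n :=
  fderiv ℝ (fun y : E n => g (‖y‖⁻¹ • y)) x (e j)

/-- `Λ = ∑_{i < j} e_i e_j (x_i ∂/∂x_j - x_j ∂/∂x_i)`, at points of `𝕊^n`. These operators are
tangential, so that only the values of `g` on `𝕊^n` matter. -/
def Lam {n : ℕ} (g : E n → Cl n) (x : E n) : Cl n :=
  ∑ i : Fin (n + 1), ∑ j ∈ Finset.Ioi i,
    ιv (e i) * ιv (e j) * (x i • spherePartial g x j - x j • spherePartial g x i)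

/-- The spherical Dirac operator `D_s = x_s (Λ + n/2)` on `𝕊^n`. -/
def diracS {n : ℕ} (g : E n → Cl n) (x : E n) : Cl n :=
  ιv x * (Lam g x + ((n : ℝ) / 2) • g x)

/-- `D_{s,x_s} F(x_s, ·)` on the subspace `W`: the spherical Dirac operator in the first variable,
the vector `w ∈ ℝ^{n+1}` being fixed during the differentiation. -/
def diracSX {n : ℕ} (W : Submodule ℝ (E n)) (F : E n → E n → Cl n) (x : E n) (w : W) : Cl n :=
  diracS (fun y => F y w) x

/-- The spherical Rarita-Schwinger type operator `R_k^S = P_k D_s` at `x ∈ 𝕊^n`, with `P_k` in the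
variable `w ∈ W`. -/
def RS {n : ℕ} (k : ℕ) (W : Submodule ℝ (E n)) (F : E n → E n → Cl n) (x : E n) : W → Cl n :=
  P k (diracSX W F x)

/-- The inverse Cayley transformation `x_s ↦ (-e_{n+1} x_s + 1)(x_s - e_{n+1})⁻¹`, that is
`-e_{n+1} + 2 (x_s - e_{n+1})⁻¹`, on `𝕊^n ∖ {e_{n+1}}`; it takes its values in `ℝ^n`. -/
def invCayley {n : ℕ} (x : E n) : Rn n :=
  toRn n (-eLast n - (2 / ‖x - eLast n‖ ^ 2) • (x - eLast n))

/-- The linear map `w ↦ y w y / ‖y‖²` of `ℝ^{n+1}`, that is `w ↦ a w ã` where `a = y / ‖y‖`. -/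
def twist {n : ℕ} (y : E n) : E n →ₗ[ℝ] E n :=
  (‖y‖ ^ 2)⁻¹ • (‖y‖ ^ 2 • LinearMap.id - (2 : ℝ) • (innerₗ (E n) y).smulRight y)

/-- The hyperplane `a⁻¹ ℝ^n ã⁻¹ = {w : a w ã ∈ ℝ^n}` with
`a = (x_s - e_{n+1}) / ‖x_s - e_{n+1}‖`. -/
def hyperplane {n : ℕ} (x : E n) : Submodule ℝ (E n) :=
  (Rn n).comap (twist (x - eLast n))

/-- `u = a w ã` with `a = (x_s - e_{n+1}) / ‖x_s - e_{n+1}‖`, for `w` in the hyperplane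
`a⁻¹ ℝ^n ã⁻¹`. -/
def uOf {n : ℕ} (x : E n) (w : hyperplane x) : Rn n :=
  ⟨twist (x - eLast n) w, w.2⟩

/-- The conformal weight `J(C⁻¹, x_s) = (x_s - e_{n+1}) / ‖x_s - e_{n+1}‖^n`. -/
def J {n : ℕ} (x : E n) : Cl n :=
  (‖x - eLast n‖ ^ n)⁻¹ • ιv (x - eLast n)

/-- The conformal weight `J_{-1}(C⁻¹, x_s) = (x_s - e_{n+1}) / ‖x_s - e_{n+1}‖^{n+2}`. -/
def Jm1 {n : ℕ} (x : E n) : Cl n :=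
  (‖x - eLast n‖ ^ (n + 2))⁻¹ • ιv (x - eLast n)

/-- The function `J(C⁻¹, x_s) f(C⁻¹(x_s), a w ã)` with `a = (x_s - e_{n+1}) / ‖x_s - e_{n+1}‖`,
for all `w ∈ ℝ^{n+1}`; here `f(x, ·)` is extended trivially from `ℝ^n` to `ℝ^{n+1}`. -/
def pullback {n : ℕ} (f : Rn n → Rn n → Cl n) (x w : E n) : Cl n :=
  J x * f (invCayley x) (toRn n (twist (x - eLast n) w))

/-! Checks that the vector formulas above agree with the Clifford-algebraic ones. -/

theorem ι_mul_self {n : ℕ} (y : E n) : ιv y * ιv y = algebraMap ℝ (Cl n) (-‖y‖ ^ 2) := by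
  rw [CliffordAlgebra.ι_sq_scalar, Q_apply]

theorem ι_mul_add_swap {n : ℕ} (x y : E n) :
    ιv x * ιv y + ιv y * ιv x = algebraMap ℝ (Cl n) (-(2 * ⟪x, y⟫_ℝ)) := by
  rw [CliffordAlgebra.ι_mul_ι_add_swap]
  congr 1
  rw [QuadraticMap.polar, Q_apply, Q_apply, Q_apply, norm_add_sq_real]
  ring

theorem ι_twist {n : ℕ} (y w : E n) :
    ιv (twist y w) = (‖y‖ ^ 2)⁻¹ • (ιv y * ιv w * ιv y) := by
  have h : ιv y * ιv w * ιv y = ‖y‖ ^ 2 • ιv w - (2 * ⟪y, w⟫_ℝ) • ιv y := by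
    rw [eq_sub_of_add_eq (ι_mul_add_swap y w), sub_mul, mul_assoc, ι_mul_self,
      ← Algebra.commutes, ← Algebra.smul_def, ← Algebra.smul_def]
    simp only [neg_smul]
    abel
  rw [h]
  simp [twist, ιv, map_sub, mul_smul]

theorem mem_Rn_iff {n : ℕ} (v : E n) : v ∈ Rn n ↔ v (Fin.last n) = 0 := by
  constructor
  · intro h
    induction h using Submodule.span_induction with
    | mem x hx =>
      obtain ⟨j, rfl⟩ := hx
      simp [e, (Fin.castSucc_lt_last j).ne']
    | zero => simp
    | add x y _ _ hx hy => simp [hx, hy]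
    | smul a x _ hx => simp [hx]
  · intro h
    have : v = ∑ j : Fin n, v j.castSucc • (e j.castSucc : E n) := by
      have := (EuclideanSpace.basisFun (Fin (n + 1)) ℝ).sum_repr v
      rw [Fin.sum_univ_castSucc] at this
      simp only [EuclideanSpace.basisFun_repr, EuclideanSpace.basisFun_apply, h, zero_smul,
        add_zero] at this
      exact this.symm
    rw [this]
    exact Submodule.sum_mem _ fun j _ =>
      Submodule.smul_mem _ _ (Submodule.subset_span ⟨j, rfl⟩)

theorem coe_invCayley {n : ℕ} (x : E n) (hx : ‖x‖ = 1) (hne : x ≠ eLast n) :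
    (invCayley x : E n) = -eLast n - (2 / ‖x - eLast n‖ ^ 2) • (x - eLast n) := by
  have h0 : ‖x - eLast n‖ ^ 2 ≠ 0 := by
    simpa [sub_eq_zero] using hne
  have h1 : ‖x - eLast n‖ ^ 2 = 2 - 2 * x (Fin.last n) := by
    rw [norm_sub_sq_real, hx]
    simp [eLast, e, EuclideanSpace.inner_single_right]
    ring
  refine Submodule.starProjection_eq_self_iff.mpr ((mem_Rn_iff _).mpr ?_)
  have h2 : x (Fin.last n) = 1 - ‖x - eLast n‖ ^ 2 / 2 := by rw [h1]; ring
  simp only [PiLp.sub_apply, PiLp.neg_apply, PiLp.smul_apply, h2]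
  have h3 : (eLast n) (Fin.last n) = 1 := by simp [eLast, e]
  rw [h3, smul_eq_mul]
  generalize ‖x - eLast n‖ ^ 2 = N at h0
  field_simp
  ring

theorem ι_invCayley {n : ℕ} (x : E n) (hx : ‖x‖ = 1) (hne : x ≠ eLast n) :
    ιv (invCayley x : E n) * ιv (x - eLast n) = -ιv (eLast n) * ιv x + 1 := by
  have h0 : ‖x - eLast n‖ ^ 2 ≠ 0 := by
    simpa [sub_eq_zero] using hne
  have h1 : ‖eLast n‖ = 1 := by simp [eLast, e]
  have h2 : ιv (eLast n) * ιv (eLast n) = -1 := by rw [ι_mul_self, h1]; simp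
  rw [coe_invCayley x hx hne]
  have h3 : ιv (-eLast n - (2 / ‖x - eLast n‖ ^ 2) • (x - eLast n)) =
      -ιv (eLast n) - (2 / ‖x - eLast n‖ ^ 2) • ιv (x - eLast n) := by
    simp [ιv, map_sub]
  have h4 : (2 / ‖x - eLast n‖ ^ 2) • algebraMap ℝ (Cl n) (-‖x - eLast n‖ ^ 2) = -2 := by
    rw [Algebra.smul_def, ← map_mul]
    have : 2 / ‖x - eLast n‖ ^ 2 * -‖x - eLast n‖ ^ 2 = -2 := by
      generalize ‖x - eLast n‖ ^ 2 = N at h0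
      field_simp
    rw [this, map_neg, map_ofNat]
  rw [h3, sub_mul, smul_mul_assoc, ι_mul_self, h4, ιv, ιv, map_sub, mul_sub, neg_mul, neg_mul, h2,
    sub_neg_eq_add, neg_neg, ← sub_eq_zero]
  have h5 : (2 : Cl n) = 1 + 1 := by norm_num
  rw [h5]
  abel

end RaritaSchwinger

end

open RaritaSchwinger

open scoped ContDiff

noncomputable section

namespace RaritaSchwinger

/-! Put y = x_s - e_{n+1}. The map w ↦ a w ã is the reflection in the hyperplane orthogonal to y, W
is the tangent space of the sphere at x_s, and C⁻¹ is, up to a translation and the factor -2, the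
inversion of y, whose derivative is ‖y‖⁻² times the same reflection. The relation w y = -y (a w ã)
(`ι_mul_ι_twist`) moves vectors of W past J at the cost of a sign, so p ↦ J p(a w ã) carries
monogenic polynomials on ℝⁿ to monogenic polynomials on W.

By `diracS_eq`, D_s is minus the tangential Dirac operator plus (n/2) x_s. On the pullback, the
derivative of J cancels the zeroth-order term (`sum_mul_fderiv_J`), and the derivative in the first
variable gives -2 J_{-1} D_x f. Since a depends on y_s, u moves too. Of the two resulting terms, one
is a multiple of the Dirac operator of f in u, hence zero; the other is w q, with q a transported
directional derivative of f in u, so q is in 𝓜_{k-1}. This is `diracSX_pullback`.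

The term w q is invisible to P_k, and P_k commutes with the transport (`IsMonogenicPart.transport`);
uniqueness of the Almansi-Fischer decomposition gives the formula. The decomposition itself rests on
D² = -Δ and on D(wq) = -(m + 2j) q for q monogenic of degree j, m = dim W. D_x f is harmonic because
derivatives in a parameter stay in the finite-dimensional, hence closed, space of monogenic
polynomials; harmonicity of D_s F is read off from its explicit decomposition. -/

instance (n : ℕ) : FiniteDimensional ℝ (Cl n) :=
  (coords n).symm.finiteDimensional

/-- Clifford multiplication as a continuous bilinear map. -/
def mulCLM (n : ℕ) : Cl n →L[ℝ] Cl n →L[ℝ] Cl n :=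
  (LinearMap.mul ℝ (Cl n)).toContinuousBilinearMap

@[simp] theorem mulCLM_apply {n : ℕ} (a b : Cl n) : mulCLM n a b = a * b := rfl

/-- The inclusion of vectors in the Clifford algebra as a continuous linear map. -/
def ιCLM (n : ℕ) : E n →L[ℝ] Cl n := LinearMap.toContinuousLinearMap (CliffordAlgebra.ι (Q n))

@[simp] theorem ιCLM_apply {n : ℕ} (x : E n) : ιCLM n x = ιv x := rfl

/-! ### Product rule for Clifford-valued functions. -/

section Calculus

variable {n : ℕ} {X : Type*} [NormedAddCommGroup X] [NormedSpace ℝ X]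

theorem differentiableAt_mul {a b : X → Cl n} {x : X} (ha : DifferentiableAt ℝ a x)
    (hb : DifferentiableAt ℝ b x) : DifferentiableAt ℝ (fun y => a y * b y) x :=
  ((mulCLM n).hasFDerivAt_of_bilinear ha.hasFDerivAt hb.hasFDerivAt).differentiableAt

theorem fderiv_mul_apply {a b : X → Cl n} {x : X} (ha : DifferentiableAt ℝ a x)
    (hb : DifferentiableAt ℝ b x) (v : X) :
    fderiv ℝ (fun y => a y * b y) x v = a x * fderiv ℝ b x v + fderiv ℝ a x v * b x := by
  have h := ((mulCLM n).hasFDerivAt_of_bilinear ha.hasFDerivAt hb.hasFDerivAt).fderiv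
  exact congrArg (fun T => T v) h

theorem fderiv_const_mul_apply {b : X → Cl n} {x : X} (c : Cl n)
    (hb : DifferentiableAt ℝ b x) (v : X) :
    fderiv ℝ (fun y => c * b y) x v = c * fderiv ℝ b x v := by
  rw [fderiv_mul_apply (differentiableAt_const c) hb]
  simp

theorem contDiff_mul {a b : X → Cl n} {r : ℕ∞ω} (ha : ContDiff ℝ r a) (hb : ContDiff ℝ r b) :
    ContDiff ℝ r (fun y => a y * b y) :=
  ((mulCLM n).contDiff.comp ha).clm_apply hb

end Calculus

/-! ### Homogeneous polynomials and Euler's identity. -/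

section Homogeneous

variable {n : ℕ} {W : Submodule ℝ (E n)}

/-- Differentiating t ↦ p(tw) = tᵏ p(w) k times at 0 recovers k! p(w) as the k-th derivative of p at
0 on (w, …, w). Closure properties then reduce to smoothness and scaling. -/
theorem isHomPoly_iff {k : ℕ} {p : W → Cl n} :
    IsHomPoly k p ↔ ContDiff ℝ ∞ p ∧ ∀ (t : ℝ) (w : W), p (t • w) = t ^ k • p w := by
  constructor
  · rintro ⟨M, hM⟩
    constructor
    · let b := stdOrthonormalBasis ℝ W
      have h : p = fun w => ∑ r : Fin k → Fin (Module.finrank ℝ W),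
          (∏ i, ⟪b (r i), w⟫_ℝ) • M fun i => b (r i) := by
        funext w
        rw [hM]
        conv_lhs => rw [← b.sum_repr' w]
        rw [MultilinearMap.map_sum M fun _ j => ⟪b j, w⟫_ℝ • b j]
        exact Finset.sum_congr rfl fun r _ => M.map_smul_univ _ _
      rw [h]
      refine ContDiff.sum fun r _ => ContDiff.fun_smul (contDiff_prod fun i _ => ?_) contDiff_const
      exact contDiff_const.inner ℝ contDiff_id
    · intro t w
      rw [hM, hM, M.map_smul_univ (fun _ => t) fun _ => w]
      simp
  · rintro ⟨hp, hh⟩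
    refine ⟨((k.factorial : ℝ)⁻¹) • (iteratedFDeriv ℝ k p 0).toMultilinearMap, fun w => ?_⟩
    let L : ℝ →L[ℝ] W := (ContinuousLinearMap.id ℝ ℝ).smulRight w
    have h1 := L.iteratedFDeriv_comp_right (f := p) hp 0 (i := k) (by exact_mod_cast le_top)
    have h2 : p ∘ L = fun t : ℝ => t ^ k • p w := by
      funext t
      simp [L, hh]
    have h3 : iteratedDeriv k (fun t : ℝ => t ^ k • p w) 0 = (k.factorial : ℝ) • p w := by
      rw [iteratedDeriv_smul_const (by fun_prop), iteratedDeriv_fun_pow_zero]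
      simp
    rw [iteratedDeriv_eq_iteratedFDeriv, ← h2, h1] at h3
    have h4 : (iteratedFDeriv ℝ k p 0) (fun _ => w) = (k.factorial : ℝ) • p w := by
      rw [← h3]
      simp [L]
    change p w = (k.factorial : ℝ)⁻¹ • (iteratedFDeriv ℝ k p 0) (fun _ => w)
    rw [h4, inv_smul_smul₀ (by exact_mod_cast k.factorial_ne_zero)]

namespace IsHomPoly

variable {k : ℕ} {p q : W → Cl n}

theorem contDiff (hp : IsHomPoly k p) : ContDiff ℝ ∞ p := (isHomPoly_iff.mp hp).1

theorem differentiable (hp : IsHomPoly k p) : Differentiable ℝ p :=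
  hp.contDiff.differentiable (by simp)

theorem map_smul (hp : IsHomPoly k p) (t : ℝ) (w : W) : p (t • w) = t ^ k • p w :=
  (isHomPoly_iff.mp hp).2 t w

theorem zero : IsHomPoly k (0 : W → Cl n) := ⟨0, fun _ => rfl⟩

theorem add (hp : IsHomPoly k p) (hq : IsHomPoly k q) : IsHomPoly k (p + q) := by
  obtain ⟨M, hM⟩ := hp
  obtain ⟨N, hN⟩ := hq
  exact ⟨M + N, fun w => by simp [hM, hN]⟩

theorem smul (c : ℝ) (hp : IsHomPoly k p) : IsHomPoly k (c • p) := by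
  obtain ⟨M, hM⟩ := hp
  exact ⟨c • M, fun w => by simp [hM]⟩

theorem sum {ι : Type*} (s : Finset ι) {p : ι → W → Cl n} (h : ∀ i ∈ s, IsHomPoly k (p i)) :
    IsHomPoly k (fun w => ∑ i ∈ s, p i w) := by
  rw [isHomPoly_iff]
  refine ⟨ContDiff.sum fun i hi => (h i hi).contDiff, fun t w => ?_⟩
  rw [Finset.smul_sum]
  exact Finset.sum_congr rfl fun i hi => (h i hi).map_smul t w

theorem const_mul (c : Cl n) (hp : IsHomPoly k p) : IsHomPoly k (fun w => c * p w) := by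
  rw [isHomPoly_iff]
  exact ⟨contDiff_mul contDiff_const hp.contDiff, fun t w => by
    rw [hp.map_smul, mul_smul_comm]⟩

theorem id_mul (hp : IsHomPoly k p) : IsHomPoly (k + 1) (fun w : W => ιv (w : E n) * p w) := by
  rw [isHomPoly_iff]
  refine ⟨contDiff_mul ((ιCLM n).comp W.subtypeL).contDiff hp.contDiff, fun t w => ?_⟩
  rw [hp.map_smul, mul_smul_comm, W.coe_smul, ιv, _root_.map_smul, smul_mul_assoc, smul_smul,
    pow_succ]

theorem comp {W' : Submodule ℝ (E n)} (σ : W' →L[ℝ] W) (hp : IsHomPoly k p) :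
    IsHomPoly k (fun w => p (σ w)) := by
  rw [isHomPoly_iff]
  exact ⟨hp.contDiff.comp σ.contDiff, fun t w => by rw [_root_.map_smul, hp.map_smul]⟩

theorem fderiv_self (hp : IsHomPoly k p) (w : W) : fderiv ℝ p w w = (k : ℝ) • p w := by
  have h1 : HasDerivAt (fun t : ℝ => p (t • w)) (fderiv ℝ p w w) 1 := by
    have h2 : HasDerivAt (fun t : ℝ => t • w) w 1 := by
      simpa using (hasDerivAt_id (1 : ℝ)).smul_const w
    have h3 : HasFDerivAt p (fderiv ℝ p w) ((1 : ℝ) • w) := by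
      simpa using (hp.differentiable w).hasFDerivAt
    exact h3.comp_hasDerivAt 1 h2
  have h4 : HasDerivAt (fun t : ℝ => p (t • w)) ((k : ℝ) • p w) 1 := by
    simp only [hp.map_smul]
    simpa using (hasDerivAt_pow k (1 : ℝ)).smul_const (p w)
  exact h1.unique h4

theorem fderiv_apply (hp : IsHomPoly (k + 1) p) (v : W) :
    IsHomPoly k (fun w => fderiv ℝ p w v) := by
  have hc : ContDiff ℝ ∞ (fun w => fderiv ℝ p w v) :=
    (hp.contDiff.fderiv_right (by simp)).clm_apply contDiff_const
  have hne : ∀ (t : ℝ) (w : W), t ≠ 0 → fderiv ℝ p (t • w) v = t ^ k • fderiv ℝ p w v := by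
    intro t w ht
    have h2 : HasFDerivAt (fun w : W => t • w) (t • ContinuousLinearMap.id ℝ W) w :=
      (hasFDerivAt_id w).const_smul t
    have h1 : HasFDerivAt (fun w => p (t • w))
        ((fderiv ℝ p (t • w)).comp (t • ContinuousLinearMap.id ℝ W)) w :=
      (hp.differentiable (t • w)).hasFDerivAt.comp w h2
    have h4 : HasFDerivAt (fun w => p (t • w)) (t ^ (k + 1) • fderiv ℝ p w) w := by
      simp only [hp.map_smul]
      exact (hp.differentiable w).hasFDerivAt.fun_const_smul _
    have h5 := congrArg (fun T => t⁻¹ • T v) (h1.unique h4)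
    simpa [smul_smul, ht, pow_succ', inv_mul_cancel_left₀] using h5
  rw [isHomPoly_iff]
  refine ⟨hc, fun t w => ?_⟩
  -- The chain rule leaves a factor t to divide by; t = 0 is reached by continuity.
  have hcont : (fun t : ℝ => fderiv ℝ p (t • w) v) = fun t => t ^ k • fderiv ℝ p w v := by
    refine Continuous.ext_on (dense_compl_singleton (0 : ℝ)) ?_ (by fun_prop)
      fun s hs => hne s w hs
    exact hc.continuous.comp (by fun_prop)
  exact congrFun hcont t

theorem fderiv_eq_zero (hp : IsHomPoly 0 p) (w v : W) : fderiv ℝ p w v = 0 := by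
  have : p = fun _ => p 0 := by
    funext w
    have := hp.map_smul 0 w
    simpa using this.symm
  rw [this]
  simp

end IsHomPoly

end Homogeneous

/-! ### The Dirac operator of a subspace. -/

section Dirac

variable {n : ℕ} {W : Submodule ℝ (E n)} {ι : Type*} [Fintype ι]

/-- Both sides are the trace of B over W. This replaces the ambient basis, used in the definitions,
by any orthonormal basis of W. -/
theorem sum_projection_eq (b : OrthonormalBasis ι ℝ W) {V : Type*} [AddCommGroup V] [Module ℝ V]
    (B : E n →ₗ[ℝ] W →ₗ[ℝ] V) :
    ∑ j, B (e j) (W.orthogonalProjectionOnto (e j)) = ∑ l, B (b l) (b l) := by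
  simp only [b.orthogonalProjectionOnto_apply_eq_sum, map_sum, map_smul]
  rw [Finset.sum_comm]
  refine Finset.sum_congr rfl fun l _ => ?_
  have h : (b l : E n) = ∑ j, ⟪(b l : E n), e j⟫_ℝ • e j := by
    conv_lhs => rw [← (EuclideanSpace.basisFun (Fin (n + 1)) ℝ).sum_repr' (b l : E n)]
    simp only [EuclideanSpace.basisFun_apply, e]
    exact Finset.sum_congr rfl fun j _ => by rw [real_inner_comm]
  conv_rhs => rw [h]
  simp [LinearMap.sum_apply]

/-- The bilinear map `(x, w) ↦ x * T w` attached to a linear map `T`. -/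
def vecMul (T : W →ₗ[ℝ] Cl n) : E n →ₗ[ℝ] W →ₗ[ℝ] Cl n :=
  ((LinearMap.mul ℝ (Cl n)).comp (CliffordAlgebra.ι (Q n))).compl₂ T

@[simp] theorem vecMul_apply (T : W →ₗ[ℝ] Cl n) (x : E n) (w : W) :
    vecMul T x w = ιv x * T w := rfl

theorem dirac_eq_sum (b : OrthonormalBasis ι ℝ W) (p : W → Cl n) (w : W) :
    dirac p w = ∑ l, ιv (b l : E n) * fderiv ℝ p w (b l) :=
  sum_projection_eq b (vecMul (fderiv ℝ p w).toLinearMap)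

theorem dirac_add {p q : W → Cl n} {w : W} (hp : DifferentiableAt ℝ p w)
    (hq : DifferentiableAt ℝ q w) : dirac (p + q) w = dirac p w + dirac q w := by
  simp [dirac, fderiv_add hp hq, mul_add, Finset.sum_add_distrib]

theorem dirac_smul (c : ℝ) {p : W → Cl n} {w : W} (hp : DifferentiableAt ℝ p w) :
    dirac (c • p) w = c • dirac p w := by
  simp [dirac, fderiv_const_smul hp, Finset.smul_sum]

theorem IsHomPoly.dirac {k : ℕ} {p : W → Cl n} (hp : IsHomPoly (k + 1) p) :
    IsHomPoly k (dirac p) :=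
  IsHomPoly.sum _ fun _ _ => (hp.fderiv_apply _).const_mul _

theorem IsHomPoly.dirac_eq_zero {p : W → Cl n} (hp : IsHomPoly 0 p) (w : W) :
    RaritaSchwinger.dirac p w = 0 := by
  simp [RaritaSchwinger.dirac, hp.fderiv_eq_zero]

theorem sum_basis_mul_self (b : OrthonormalBasis ι ℝ W) (c : Cl n) :
    ∑ l, ιv (b l : E n) * (ιv (b l : E n) * c) = -(Module.finrank ℝ W : ℝ) • c := by
  have h (l : ι) : ιv (b l : E n) * (ιv (b l : E n) * c) = (-1 : ℝ) • c := by
    have : ‖(b l : E n)‖ = 1 := b.orthonormal.1 l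
    rw [← mul_assoc, ι_mul_self, this, ← Algebra.smul_def]
    norm_num
  rw [Finset.sum_congr rfl fun l _ => h l, Finset.sum_const, Finset.card_univ,
    Module.finrank_eq_card_basis b.toBasis, ← Nat.cast_smul_eq_nsmul ℝ, smul_smul]
  simp

/-- Moving each b_l past w costs -2⟨b_l, w⟩; these terms add up to -2k q by Euler's identity, and Σ
b_l² gives minus the dimension. -/
theorem dirac_id_mul {k : ℕ} {q : W → Cl n} (hq : IsHomPoly k q) (w : W) :
    dirac (fun w : W => ιv (w : E n) * q w) w =
      -((Module.finrank ℝ W : ℝ) + 2 * k) • q w - ιv (w : E n) * dirac q w := by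
  let b := stdOrthonormalBasis ℝ W
  have hd (v : W) : fderiv ℝ (fun w : W => ιv (w : E n) * q w) w v =
      ιv (w : E n) * fderiv ℝ q w v + ιv (v : E n) * q w := by
    have h : HasFDerivAt (fun w : W => ιv (w : E n)) ((ιCLM n).comp W.subtypeL) w :=
      ((ιCLM n).comp W.subtypeL).hasFDerivAt
    rw [fderiv_mul_apply h.differentiableAt (hq.differentiable w), h.fderiv]
    rfl
  have hs (l) : ιv (b l : E n) * (ιv (w : E n) * fderiv ℝ q w (b l)) =
      (-2 : ℝ) • fderiv ℝ q w (⟪b l, w⟫_ℝ • b l) -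
        ιv (w : E n) * (ιv (b l : E n) * fderiv ℝ q w (b l)) := by
    rw [← mul_assoc, eq_sub_of_add_eq (ι_mul_add_swap (b l : E n) (w : E n)), sub_mul, mul_assoc,
      ← Algebra.smul_def, map_smul, smul_smul, neg_mul]
    rfl
  rw [dirac_eq_sum b, dirac_eq_sum b]
  simp only [hd, mul_add, Finset.sum_add_distrib, sum_basis_mul_self]
  simp only [hs, Finset.sum_sub_distrib, ← Finset.smul_sum, ← map_sum, b.sum_repr', hq.fderiv_self,
    ← Finset.mul_sum]
  module

theorem differentiable_fderiv {p : W → Cl n} (hp : ContDiff ℝ ∞ p) :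
    Differentiable ℝ (fderiv ℝ p) :=
  (hp.fderiv_right (m := 1) (by norm_cast)).differentiable (by simp)

theorem fderiv_fderiv_apply {p : W → Cl n} (hp : ContDiff ℝ ∞ p) (w v u : W) :
    fderiv ℝ (fun w => fderiv ℝ p w v) w u = fderiv ℝ (fderiv ℝ p) w u v := by
  rw [fderiv_clm_apply (differentiable_fderiv hp w) (differentiableAt_const v)]
  simp

theorem isSymmSndFDerivAt {p : W → Cl n} (hp : ContDiff ℝ ∞ p) (w : W) :
    IsSymmSndFDerivAt ℝ p w :=
  hp.contDiffAt.isSymmSndFDerivAt <| by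
    rw [minSmoothness_of_isRCLikeNormedField]
    exact WithTop.coe_le_coe.mpr (le_top : (2 : ℕ∞) ≤ ⊤)

theorem fderiv_dirac_apply (b : OrthonormalBasis ι ℝ W) {p : W → Cl n} (hp : ContDiff ℝ ∞ p)
    (w u : W) : fderiv ℝ (dirac p) w u =
      ∑ l, ιv (b l : E n) * fderiv ℝ (fderiv ℝ p) w u (b l) := by
  have hd (v : W) : DifferentiableAt ℝ (fun w => fderiv ℝ p w v) w :=
    (differentiable_fderiv hp w).clm_apply (differentiableAt_const v)
  have : dirac p = fun w => ∑ l, ιv (b l : E n) * fderiv ℝ p w (b l) := by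
    funext w
    exact dirac_eq_sum b p w
  rw [this, fderiv_fun_sum fun l _ => differentiableAt_mul (differentiableAt_const _) (hd _)]
  simp only [sum_apply, fderiv_const_mul_apply _ (hd _), fderiv_fderiv_apply hp]

theorem dirac_fderiv_apply {p : W → Cl n} (hp : ContDiff ℝ ∞ p) (w v : W) :
    dirac (fun w => fderiv ℝ p w v) w = fderiv ℝ (dirac p) w v := by
  rw [dirac_eq_sum (stdOrthonormalBasis ℝ W), fderiv_dirac_apply (stdOrthonormalBasis ℝ W) hp]
  refine Finset.sum_congr rfl fun l _ => ?_
  rw [fderiv_fderiv_apply hp, (isSymmSndFDerivAt hp w).eq]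

/-- Averaging the double sum with its transpose, by symmetry of the second derivative, cancels the
off-diagonal terms, since distinct basis vectors anticommute. -/
theorem dirac_dirac {p : W → Cl n} (hp : ContDiff ℝ ∞ p) (w : W) :
    dirac (dirac p) w = -Δ p w := by
  let b := stdOrthonormalBasis ℝ W
  have h2 : dirac (dirac p) w = ∑ l, ∑ m, ιv (b l : E n) * (ιv (b m : E n) *
      fderiv ℝ (fderiv ℝ p) w (b l) (b m)) := by
    rw [dirac_eq_sum b]
    simp only [fderiv_dirac_apply b hp, Finset.mul_sum]
  have h3 : dirac (dirac p) w = ∑ l, ∑ m, ιv (b m : E n) * (ιv (b l : E n) *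
      fderiv ℝ (fderiv ℝ p) w (b l) (b m)) := by
    rw [h2, Finset.sum_comm]
    refine Finset.sum_congr rfl fun l _ => Finset.sum_congr rfl fun m _ => ?_
    rw [(isSymmSndFDerivAt hp w).eq]
  have h4 : dirac (dirac p) w + dirac (dirac p) w = -Δ p w + -Δ p w := by
    nth_rewrite 1 [h2]
    rw [h3, ← Finset.sum_add_distrib, InnerProductSpace.laplacian_eq_iteratedFDeriv_orthonormalBasis p b,
      ← Finset.sum_neg_distrib, ← Finset.sum_add_distrib]
    refine Finset.sum_congr rfl fun l _ => ?_
    rw [← Finset.sum_add_distrib, Finset.sum_eq_single l]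
    · have : ‖(b l : E n)‖ = 1 := b.orthonormal.1 l
      rw [← mul_assoc, ι_mul_self, this, iteratedFDeriv_two_apply]
      simp
    · intro m _ hm
      have : ⟪(b l : E n), (b m : E n)⟫_ℝ = 0 := b.orthonormal.2 hm.symm
      rw [← mul_assoc, ← mul_assoc, ← add_mul, ι_mul_add_swap, this]
      simp
    · simp
  have h5 : (2 : ℝ) • dirac (dirac p) w = (2 : ℝ) • -Δ p w := by
    rw [two_smul, two_smul, h4]
  exact smul_right_injective _ two_ne_zero h5

end Dirac

/-! ### The Almansi-Fischer decomposition. -/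

section Harmonic

variable {n k : ℕ} {W : Submodule ℝ (E n)} {h p q : W → Cl n}

theorem IsMonogenic.dirac_eq_zero (hp : IsMonogenic k p) : dirac p = 0 := funext hp.2

theorem IsMonogenic.zero : IsMonogenic k (0 : W → Cl n) :=
  ⟨IsHomPoly.zero, fun w => by simp [dirac]⟩

theorem IsMonogenic.add (hp : IsMonogenic k p) (hq : IsMonogenic k q) : IsMonogenic k (p + q) :=
  ⟨hp.1.add hq.1, fun w => by
    rw [dirac_add (hp.1.differentiable w) (hq.1.differentiable w), hp.2, hq.2, add_zero]⟩

theorem IsMonogenic.smul (c : ℝ) (hp : IsMonogenic k p) : IsMonogenic k (c • p) :=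
  ⟨hp.1.smul c, fun w => by rw [dirac_smul c (hp.1.differentiable w), hp.2, smul_zero]⟩

theorem isHarmonic_iff :
    IsHarmonic k h ↔ IsHomPoly k h ∧ ∀ w, dirac (dirac h) w = 0 := by
  refine and_congr_right fun hh => forall_congr' fun w => ?_
  rw [dirac_dirac hh.contDiff, neg_eq_zero]

theorem IsMonogenic.isHarmonic (hp : IsMonogenic k p) : IsHarmonic k p := by
  refine isHarmonic_iff.mpr ⟨hp.1, fun w => ?_⟩
  rw [hp.dirac_eq_zero]
  simp [dirac]

theorem IsHarmonic.zero : IsHarmonic k (0 : W → Cl n) := IsMonogenic.zero.isHarmonic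

theorem IsHomPoly.contDiffAt_two (hp : IsHomPoly k p) (w : W) : ContDiffAt ℝ 2 p w :=
  hp.contDiff.contDiffAt.of_le (WithTop.coe_le_coe.mpr (le_top : (2 : ℕ∞) ≤ ⊤))

theorem IsHarmonic.add (hp : IsHarmonic k p) (hq : IsHarmonic k q) : IsHarmonic k (p + q) :=
  ⟨hp.1.add hq.1, fun w => by
    rw [(hp.1.contDiffAt_two w).laplacian_add (hq.1.contDiffAt_two w), hp.2, hq.2, add_zero]⟩

theorem IsHarmonic.const_mul (c : Cl n) (hp : IsHarmonic k p) :
    IsHarmonic k (fun w => c * p w) :=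
  ⟨hp.1.const_mul c, fun w => by
    have := (hp.1.contDiffAt_two w).laplacian_CLM_comp_left (l := mulCLM n c)
    simp only [Function.comp_apply, hp.2, map_zero] at this
    exact this⟩

theorem isHarmonic_id_mul (hq : IsMonogenic k q) :
    IsHarmonic (k + 1) (fun w : W => ιv (w : E n) * q w) := by
  refine isHarmonic_iff.mpr ⟨hq.1.id_mul, fun w => ?_⟩
  have : dirac (fun w : W => ιv (w : E n) * q w) =
      (-((Module.finrank ℝ W : ℝ) + 2 * k)) • q := by
    funext w
    rw [dirac_id_mul hq.1, hq.2, mul_zero, sub_zero]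
    rfl
  rw [this, dirac_smul _ (hq.1.differentiable w), hq.2, smul_zero]

theorem IsMonogenicPart.isHarmonic (hp : IsMonogenicPart k h p) : IsHarmonic k h := by
  obtain ⟨hp, q, hq, hh⟩ := hp
  cases k with
  | zero =>
    have : h = p := by
      funext w
      rw [hh, hq w, mul_zero, add_zero]
    rw [this]
    exact hp.isHarmonic
  | succ k =>
    have : h = p + fun w : W => ιv (w : E n) * q w := funext hh
    rw [this]
    exact hp.isHarmonic.add (isHarmonic_id_mul hq)

theorem eq_zero_of_finrank_eq_zero (hW : Module.finrank ℝ W = 0) (w : W) : w = 0 :=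
  have := Module.finrank_zero_iff.mp hW
  Subsingleton.elim w 0

/-- With D h monogenic, D(w D h) is a nonzero multiple of D h, so a multiple of w D h corrects h to
a monogenic polynomial. -/
theorem IsHarmonic.exists_isMonogenicPart (hh : IsHarmonic k h) :
    ∃ p, IsMonogenicPart k h p := by
  cases k with
  | zero =>
    exact ⟨h, ⟨hh.1, hh.1.dirac_eq_zero⟩, 0, fun _ => rfl, fun w => by simp⟩
  | succ k =>
    -- The constant dim W + 2k to be inverted vanishes when W = 0 and k = 0.
    rcases Nat.eq_zero_or_pos (Module.finrank ℝ W) with hW | hW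
    · refine ⟨h, ⟨hh.1, fun w => ?_⟩, 0, IsMonogenic.zero, fun w => by simp⟩
      simp [dirac, eq_zero_of_finrank_eq_zero hW]
    · have hd : IsMonogenic k (dirac h) := ⟨hh.1.dirac, (isHarmonic_iff.mp hh).2⟩
      have hc : (Module.finrank ℝ W : ℝ) + 2 * k ≠ 0 := by positivity
      set c : ℝ := (Module.finrank ℝ W : ℝ) + 2 * k
      have hid : IsHomPoly (k + 1) (fun w : W => ιv (w : E n) * dirac h w) := hd.1.id_mul
      refine ⟨h + c⁻¹ • fun w : W => ιv (w : E n) * dirac h w, ⟨hh.1.add (hid.smul _), fun w => ?_⟩,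
        (-c⁻¹) • dirac h, hd.smul _, fun w => ?_⟩
      · rw [dirac_add (hh.1.differentiable w) ((hid.smul _).differentiable w),
          dirac_smul _ (hid.differentiable w), dirac_id_mul hd.1, hd.2, mul_zero, sub_zero, smul_smul,
          mul_neg, inv_mul_cancel₀ hc]
        simp
      · simp

/-- Applying D to h = p + wq determines q, hence p. -/
theorem IsMonogenicPart.unique {p' : W → Cl n} (hp : IsMonogenicPart k h p)
    (hp' : IsMonogenicPart k h p') : p = p' := by
  obtain ⟨hp, q, hq, hh⟩ := hp
  obtain ⟨hp', q', hq', hh'⟩ := hp'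
  funext w
  cases k with
  | zero =>
    have := hh w
    rw [hh', hq w, hq' w] at this
    simpa using this.symm
  | succ k =>
    rcases Nat.eq_zero_or_pos (Module.finrank ℝ W) with hW | hW
    · have := hh w
      rw [hh', eq_zero_of_finrank_eq_zero hW w] at this
      simpa [eq_zero_of_finrank_eq_zero hW w] using this.symm
    · have hc : (Module.finrank ℝ W : ℝ) + 2 * k ≠ 0 := by positivity
      have key {p q : W → Cl n} (hp : IsMonogenic (k + 1) p) (hq : IsMonogenic k q)
          (hh : ∀ w : W, h w = p w + ιv (w : E n) * q w) :
          dirac h w = -((Module.finrank ℝ W : ℝ) + 2 * k) • q w := by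
        have : h = p + fun w : W => ιv (w : E n) * q w := funext hh
        rw [this, dirac_add (hp.1.differentiable w) (hq.1.id_mul.differentiable w), hp.2,
          dirac_id_mul hq.1, hq.2]
        simp
      have h1 := (key hp hq hh).symm.trans (key hp' hq' hh')
      have h2 := smul_right_injective (Cl n) (neg_ne_zero.mpr hc) h1
      have h3 := (hh w).symm.trans (hh' w)
      rw [h2] at h3
      exact add_right_cancel h3

theorem IsHarmonic.isMonogenicPart_P (hh : IsHarmonic k h) : IsMonogenicPart k h (P k h) := by
  have H := hh.exists_isMonogenicPart
  rw [P, dif_pos H]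
  exact H.choose_spec

/-- Constant-direction derivatives commute with D; in degree 0 they vanish, in accordance with
𝓜_{-1} = 0. -/
theorem IsMonogenic.isMonogenicPred_fderiv (hp : IsMonogenic k p) (v : W) :
    IsMonogenicPred k (fun w => fderiv ℝ p w v) := by
  cases k with
  | zero => exact fun w => hp.1.fderiv_eq_zero w v
  | succ k =>
    refine ⟨hp.1.fderiv_apply v, fun w => ?_⟩
    rw [dirac_fderiv_apply hp.1.contDiff, hp.dirac_eq_zero]
    simp

theorem IsMonogenicPart.add_id_mul (hp : IsMonogenicPart k h p) (hq : IsMonogenicPred k q) :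
    IsMonogenicPart k (fun w : W => h w + ιv (w : E n) * q w) p := by
  obtain ⟨hp, r, hr, hh⟩ := hp
  refine ⟨hp, r + q, ?_, fun w => ?_⟩
  · cases k with
    | zero => exact fun w => by simp [hr w, hq w]
    | succ k => exact IsMonogenic.add hr hq
  · simp only [hh, Pi.add_apply, mul_add, add_assoc]

end Harmonic

/-! ### Transport of monogenic polynomials along isometries. -/

section Transport

variable {n k : ℕ} {W W' : Submodule ℝ (E n)} (σ : W ≃ₗᵢ[ℝ] W') {c : Cl n}
  (hc : ∀ w : W, ιv (w : E n) * c = -(c * ιv (σ w : E n)))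

include hc

/-- Each b_l turns into -σ(b_l) on passing c, and the σ(b_l) form an orthonormal basis of the
target. -/
theorem dirac_transport {p : W' → Cl n} (hp : Differentiable ℝ p) (w : W) :
    dirac (fun w => c * p (σ w)) w = -(c * dirac p (σ w)) := by
  let b := stdOrthonormalBasis ℝ W
  have hd : DifferentiableAt ℝ (fun w => p (σ w)) w :=
    (hp _).comp w σ.toContinuousLinearEquiv.differentiableAt
  have h1 (v : W) : fderiv ℝ (fun w => p (σ w)) w v = fderiv ℝ p (σ w) (σ v) := by
    have h : HasFDerivAt (fun w => p (σ w))
        ((fderiv ℝ p (σ w)).comp (σ.toContinuousLinearEquiv : W →L[ℝ] W')) w :=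
      (hp (σ w)).hasFDerivAt.comp w σ.toContinuousLinearEquiv.hasFDerivAt
    rw [h.fderiv]
    rfl
  rw [dirac_eq_sum b, dirac_eq_sum (b.map σ), Finset.mul_sum, ← Finset.sum_neg_distrib]
  refine Finset.sum_congr rfl fun l _ => ?_
  rw [fderiv_const_mul_apply c hd, h1, ← mul_assoc, hc, ← mul_assoc, neg_mul, b.map_apply]

theorem IsMonogenic.transport {p : W' → Cl n} (hp : IsMonogenic k p) :
    IsMonogenic k (fun w => c * p (σ w)) := by
  refine ⟨(hp.1.comp (σ.toContinuousLinearEquiv : W →L[ℝ] W')).const_mul c, fun w => ?_⟩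
  rw [dirac_transport σ hc hp.1.differentiable, hp.2, mul_zero, neg_zero]

theorem IsMonogenicPred.transport {p : W' → Cl n} (hp : IsMonogenicPred k p) :
    IsMonogenicPred k (fun w => c * p (σ w)) := by
  cases k with
  | zero => exact fun w => by simp [hp (σ w)]
  | succ k => exact IsMonogenic.transport σ hc hp

theorem IsMonogenicPart.transport {h p : W' → Cl n} (hp : IsMonogenicPart k h p) :
    IsMonogenicPart k (fun w => c * h (σ w)) (fun w => c * p (σ w)) := by
  obtain ⟨hp, q, hq, hh⟩ := hp
  have hc' (w : W) : ιv (w : E n) * -c = -(-c * ιv (σ w : E n)) := by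
    rw [mul_neg, hc, neg_mul]
  -- The second component is transported with -c, because c σ(w) = -w c.
  refine ⟨hp.transport σ hc, _, hq.transport σ hc', fun w => ?_⟩
  simp only [hh, mul_add, neg_mul, mul_neg, ← mul_assoc, hc, neg_neg]

end Transport

/-! ### Differentiation of families of monogenic polynomials. -/

section Parametric

variable {n k : ℕ} {W : Submodule ℝ (E n)} {X : Type*} [NormedAddCommGroup X] [NormedSpace ℝ X]

/-- Homogeneous polynomials of degree `k`, as a subspace of the space of functions. -/
def homPoly (k : ℕ) (W : Submodule ℝ (E n)) : Submodule ℝ (W → Cl n) where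
  carrier := {p | IsHomPoly k p}
  add_mem' := IsHomPoly.add
  zero_mem' := IsHomPoly.zero
  smul_mem' c _ hp := hp.smul c

/-- Monogenic polynomials of degree `k`, as a subspace of the space of functions. -/
def monogenic (k : ℕ) (W : Submodule ℝ (E n)) : Submodule ℝ (W → Cl n) where
  carrier := {p | IsMonogenic k p}
  add_mem' := IsMonogenic.add
  zero_mem' := IsMonogenic.zero
  smul_mem' c _ hp := hp.smul c

instance : FiniteDimensional ℝ (homPoly k W) := by
  let L : MultilinearMap ℝ (fun _ : Fin k => W) (Cl n) →ₗ[ℝ] (W → Cl n) :=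
    { toFun := fun M w => M fun _ => w
      map_add' := fun _ _ => rfl
      map_smul' := fun _ _ => rfl }
  have : homPoly k W = LinearMap.range L := by
    ext p
    constructor
    · rintro ⟨M, hM⟩
      exact ⟨M, (funext hM).symm⟩
    · rintro ⟨M, rfl⟩
      exact ⟨M, fun _ => rfl⟩
  rw [this]
  infer_instance

instance : FiniteDimensional ℝ (monogenic k W) :=
  Submodule.finiteDimensional_of_le (S₂ := homPoly k W) fun _ hp => hp.1

/-- The topology is that of pointwise convergence, so pointwise limits of difference quotients are
covered. -/
theorem isClosed_setOf_isMonogenic : IsClosed {p : W → Cl n | IsMonogenic k p} :=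
  (monogenic k W).closed_of_finiteDimensional

/-- A derivative with respect to a parameter of monogenic polynomials is monogenic. -/
theorem isMonogenic_fderiv_param {f : X → W → Cl n} {U : Set X} {x : X} (hU : U ∈ nhds x)
    (hd : ∀ u, DifferentiableAt ℝ (fun y => f y u) x) (hf : ∀ y ∈ U, IsMonogenic k (f y)) (v : X) :
    IsMonogenic k (fun u => fderiv ℝ (fun y => f y u) x v) := by
  have hlim : Filter.Tendsto (fun t : ℝ => t⁻¹ • (f (x + t • v) - f x)) (nhdsWithin 0 {0}ᶜ)
      (nhds fun u => fderiv ℝ (fun y => f y u) x v) := by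
    rw [tendsto_pi_nhds]
    intro u
    exact ((hd u).hasFDerivAt.hasLineDerivAt v).tendsto_slope_zero
  refine isClosed_setOf_isMonogenic.mem_of_tendsto hlim (nhdsWithin_le_nhds ?_)
  have hcont : Filter.Tendsto (fun t : ℝ => x + t • v) (nhds 0) (nhds x) := by
    have : Continuous fun t : ℝ => x + t • v := by fun_prop
    simpa using this.tendsto 0
  filter_upwards [hcont hU] with t ht
  exact (monogenic k W).smul_mem _ ((monogenic k W).sub_mem (hf _ ht) (hf x (mem_of_mem_nhds hU)))

/-- Left multiplication by a constant commutes with Δ but in general not with D: harmonicity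
survives where monogenicity need not. -/
theorem isHarmonic_sum_const_mul {ι : Type*} (s : Finset ι) (c : ι → Cl n) {p : ι → W → Cl n}
    (hp : ∀ i, IsMonogenic k (p i)) : IsHarmonic k (fun w => ∑ i ∈ s, c i * p i w) := by
  have : (fun w => ∑ i ∈ s, c i * p i w) = ∑ i ∈ s, fun w => c i * p i w := by
    funext w
    simp
  rw [this]
  exact Finset.sum_induction _ (IsHarmonic k) (fun _ _ => IsHarmonic.add) IsHarmonic.zero
    fun i _ => (hp i).isHarmonic.const_mul (c i)

end Parametric

/-! ### The reflection w ↦ a w ã. -/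

section Reflection

variable {n : ℕ} {y : E n}

/-- The grouping isolates the inversion y / ‖y‖², so that its derivative can be reused for the
reflection. -/
theorem twist_apply (hy : y ≠ 0) (w : E n) :
    twist y w = w - ⟪y, w⟫_ℝ • (2 : ℝ) • ((‖y‖ ^ 2)⁻¹ • y) := by
  have h0 : ‖y‖ ^ 2 ≠ 0 := by simpa using hy
  simp only [twist, LinearMap.smul_apply, LinearMap.sub_apply, LinearMap.id_apply,
    LinearMap.smulRight_apply, innerₗ_apply_apply, smul_sub, smul_smul]
  rw [inv_mul_cancel₀ h0, one_smul]
  congr 2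
  ring

theorem inner_twist_self (hy : y ≠ 0) (w : E n) : ⟪y, twist y w⟫_ℝ = -⟪y, w⟫_ℝ := by
  have h0 : ‖y‖ ^ 2 ≠ 0 := by simpa using hy
  rw [twist_apply hy, inner_sub_right, inner_smul_right, inner_smul_right, inner_smul_right,
    real_inner_self_eq_norm_sq, inv_mul_cancel₀ h0]
  ring

theorem twist_twist (hy : y ≠ 0) (w : E n) : twist y (twist y w) = w := by
  rw [twist_apply hy (twist y w), inner_twist_self hy, twist_apply hy w]
  module

theorem inner_twist_twist (hy : y ≠ 0) (v w : E n) : ⟪twist y v, twist y w⟫_ℝ = ⟪v, w⟫_ℝ := by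
  conv_lhs => rw [twist_apply hy v]
  rw [inner_sub_left, inner_smul_left, inner_smul_left, inner_smul_left, inner_twist_self hy,
    twist_apply hy w, inner_sub_right, inner_smul_right, inner_smul_right, inner_smul_right,
    real_inner_comm y v]
  simp
  ring

theorem ι_mul_ι_twist (hy : y ≠ 0) (w : E n) :
    ιv w * ιv y = -(ιv y * ιv (twist y w)) := by
  have h0 : ‖y‖ ^ 2 ≠ 0 := by simpa using hy
  rw [ι_twist, mul_smul_comm, ← mul_assoc, ← mul_assoc, ι_mul_self, ← Algebra.smul_def,
    smul_mul_assoc, smul_smul, mul_neg, inv_mul_cancel₀ h0, neg_smul, one_smul, neg_neg]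

end Reflection

/-! ### The tangent hyperplane and its isometry with ℝⁿ. -/

section Hyperplane

variable {n : ℕ} {x : E n}

theorem norm_eLast : ‖eLast n‖ = 1 := by simp [eLast, e]

theorem inner_eLast (v : E n) : ⟪eLast n, v⟫_ℝ = v (Fin.last n) := by
  simp [eLast, e, EuclideanSpace.inner_single_left]

theorem inner_eLast_sub (hx : ‖x‖ = 1) :
    ⟪eLast n, x - eLast n⟫_ℝ = -(‖x - eLast n‖ ^ 2 / 2) := by
  rw [norm_sub_sq_real, hx, norm_eLast, inner_sub_right, real_inner_self_eq_norm_sq, norm_eLast,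
    real_inner_comm]
  ring

theorem inner_sub_eLast (hx : ‖x‖ = 1) :
    ⟪x, x - eLast n⟫_ℝ = ‖x - eLast n‖ ^ 2 / 2 := by
  rw [norm_sub_sq_real, hx, norm_eLast, inner_sub_right, real_inner_self_eq_norm_sq, hx]
  ring

/-- The hyperplane `a⁻¹ ℝ^n ã⁻¹` is the tangent space of the sphere. -/
theorem mem_hyperplane_iff (hx : ‖x‖ = 1) (hne : x ≠ eLast n) (w : E n) :
    w ∈ hyperplane x ↔ ⟪x, w⟫_ℝ = 0 := by
  have hy : x - eLast n ≠ 0 := sub_ne_zero.mpr hne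
  have h0 : ‖x - eLast n‖ ^ 2 ≠ 0 := by simpa using hy
  rw [hyperplane, Submodule.mem_comap, mem_Rn_iff, ← inner_eLast, twist_apply hy, inner_sub_right,
    inner_smul_right, inner_smul_right, inner_smul_right, inner_eLast_sub hx]
  -- As ⟨e_{n+1}, y⟩ = -‖y‖²/2, the reflection adds ⟨y, w⟩ to the last coordinate of w.
  have : ⟪eLast n, w⟫_ℝ - ⟪x - eLast n, w⟫_ℝ * (2 * ((‖x - eLast n‖ ^ 2)⁻¹ *
      -(‖x - eLast n‖ ^ 2 / 2))) = ⟪x, w⟫_ℝ := by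
    rw [inner_sub_left]
    generalize ‖x - eLast n‖ ^ 2 = N at h0
    field_simp
    ring
  rw [this]

theorem coe_projection_hyperplane (hx : ‖x‖ = 1) (hne : x ≠ eLast n) (v : E n) :
    ((hyperplane x).orthogonalProjectionOnto v : E n) = v - ⟪x, v⟫_ℝ • x := by
  refine Submodule.eq_starProjection_of_mem_of_inner_eq_zero
    ((mem_hyperplane_iff hx hne _).mpr ?_) fun w hw => ?_
  · rw [inner_sub_right, inner_smul_right, real_inner_self_eq_norm_sq, hx]
    ring
  · rw [sub_sub_cancel, inner_smul_left, (mem_hyperplane_iff hx hne w).mp hw, mul_zero]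

/-- The isometry `w ↦ a w ã` of the hyperplane `a⁻¹ ℝ^n ã⁻¹` onto `ℝ^n`. -/
def uEquiv (hne : x ≠ eLast n) : hyperplane x ≃ₗᵢ[ℝ] Rn n where
  toFun := uOf x
  invFun u := ⟨twist (x - eLast n) u, by
    rw [hyperplane, Submodule.mem_comap, twist_twist (sub_ne_zero.mpr hne)]
    exact u.2⟩
  map_add' v w := Subtype.ext (map_add (twist (x - eLast n)) (v : E n) (w : E n))
  map_smul' c w := Subtype.ext (map_smul (twist (x - eLast n)) c (w : E n))
  left_inv w := Subtype.ext (twist_twist (sub_ne_zero.mpr hne) _)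
  right_inv u := Subtype.ext (twist_twist (sub_ne_zero.mpr hne) _)
  norm_map' w := by
    have h := inner_twist_twist (sub_ne_zero.mpr hne) (w : E n) w
    rw [real_inner_self_eq_norm_sq, real_inner_self_eq_norm_sq] at h
    exact (pow_left_inj₀ (norm_nonneg _) (norm_nonneg _) two_ne_zero).mp h

theorem uEquiv_apply (hne : x ≠ eLast n) (w : hyperplane x) : uEquiv hne w = uOf x w := rfl

theorem toRn_twist (w : hyperplane x) : toRn n (twist (x - eLast n) w) = uOf x w :=
  (Rn n).orthogonalProjectionOnto_mem_subspace_eq_self (uOf x w)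

theorem finrank_Rn : Module.finrank ℝ (Rn n) = n := by
  have h : Orthonormal ℝ fun j : Fin n => (e j.castSucc : E n) := by
    have := (EuclideanSpace.basisFun (Fin (n + 1)) ℝ).orthonormal.comp _ (Fin.castSucc_injective n)
    simpa [Function.comp_def, e] using this
  rw [Rn, finrank_span_eq_card h.linearIndependent, Fintype.card_fin]

theorem finrank_hyperplane (hne : x ≠ eLast n) : Module.finrank ℝ (hyperplane x) = n :=
  (uEquiv hne).toLinearEquiv.finrank_eq.trans finrank_Rn

end Hyperplane

/-! ### The spherical Dirac operator in tangential form. -/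

section Sphere

variable {n : ℕ} {x : E n}

theorem hasFDerivAt_norm {X : Type*} [NormedAddCommGroup X] [InnerProductSpace ℝ X] {y : X}
    (hy : y ≠ 0) : HasFDerivAt (fun z : X => ‖z‖) (‖y‖⁻¹ • innerSL ℝ y) y := by
  have h := ((contDiffAt_norm ℝ hy (n := 1)).differentiableAt (by simp)).hasFDerivAt
  have h1 := h.pow 2
  have h2 := (hasStrictFDerivAt_norm_sq y).hasFDerivAt
  have h3 := h1.unique h2
  have h0 : ‖y‖ ≠ 0 := by simpa using hy
  refine h.congr_fderiv ?_
  ext v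
  symm
  have h4 := DFunLike.congr_fun h3 v
  simp at h4
  change ‖y‖⁻¹ * ⟪y, v⟫_ℝ = _
  field_simp
  linarith

theorem hasFDerivAt_normalize (hx : ‖x‖ = 1) :
    HasFDerivAt (fun y : E n => ‖y‖⁻¹ • y)
      (ContinuousLinearMap.id ℝ (E n) - (innerSL ℝ x).smulRight x) x := by
  have h0 : x ≠ 0 := by
    rintro rfl
    simp at hx
  have h1 := ((hasDerivAt_inv (norm_ne_zero_iff.mpr h0)).comp_hasFDerivAt x
    (hasFDerivAt_norm h0)).fun_smul (hasFDerivAt_id x)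
  refine h1.congr_fderiv ?_
  ext1 v
  simp [hx, sub_eq_add_neg]

theorem spherePartial_eq (hx : ‖x‖ = 1) (hne : x ≠ eLast n) {g : E n → Cl n}
    (hg : DifferentiableAt ℝ g x) (j : Fin (n + 1)) :
    spherePartial g x j =
      fderiv ℝ g x ((hyperplane x).orthogonalProjectionOnto (e j)) := by
  have hg' : HasFDerivAt g (fderiv ℝ g x) (‖x‖⁻¹ • x) := by
    simpa [hx] using hg.hasFDerivAt
  have h := HasFDerivAt.comp (f := fun y : E n => ‖y‖⁻¹ • y) x hg' (hasFDerivAt_normalize hx)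
  rw [spherePartial, coe_projection_hyperplane hx hne]
  change fderiv ℝ (g ∘ fun y : E n => ‖y‖⁻¹ • y) x (e j) = _
  rw [h.fderiv]
  simp

/-- In the product on the right the diagonal terms sum to -Σ x_i s_i = 0; the others pair up by
anticommutation. -/
theorem sum_ι_mul_eq (x : E n) (s : Fin (n + 1) → Cl n) (hs : ∑ j, x j • s j = 0) :
    ∑ i : Fin (n + 1), ∑ j ∈ Finset.Ioi i, ιv (e i : E n) * ιv (e j) * (x i • s j - x j • s i) =
      ιv x * ∑ j, ιv (e j) * s j := by
  let f : Fin (n + 1) → Fin (n + 1) → Cl n := fun j i => x i • (ιv (e i) * (ιv (e j) * s j))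
  have hx : ιv x = ∑ i, x i • ιv (e i : E n) := by
    have h := (EuclideanSpace.basisFun (Fin (n + 1)) ℝ).sum_repr x
    simp only [EuclideanSpace.basisFun_repr, EuclideanSpace.basisFun_apply] at h
    conv_lhs => rw [← h]
    simp [ιv, e]
  have hn (i : Fin (n + 1)) : ‖(e i : E n)‖ = 1 := by simp [e]
  have h1 : ιv x * ∑ j, ιv (e j) * s j = ∑ i, ∑ j, f j i := by
    rw [hx, Finset.sum_mul]
    refine Finset.sum_congr rfl fun i _ => ?_
    rw [Finset.mul_sum]
    refine Finset.sum_congr rfl fun j _ => ?_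
    rw [smul_mul_assoc]
  have h2 : ∑ i, f i i = 0 := by
    have h (i : Fin (n + 1)) : f i i = -(x i • s i) := by
      simp only [f]
      rw [← mul_assoc, ι_mul_self, hn, ← Algebra.smul_def]
      simp
    simp only [h, Finset.sum_neg_distrib, hs, neg_zero]
  have h3 : ∑ i, ∑ j, f j i = ∑ i, ∑ j ∈ Finset.Ioi i, (f j i + f i j) := by
    rw [Finset.sum_sum_Ioi_add_eq_sum_sum_off_diag, ← add_zero (∑ i, ∑ j ∈ {i}ᶜ, f j i), ← h2,
      ← Finset.sum_add_distrib]
    refine Finset.sum_congr rfl fun i _ => ?_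
    exact (Fintype.sum_eq_add_sum_compl i _).trans (add_comm _ _)
  rw [h1, h3]
  refine Finset.sum_congr rfl fun i _ => Finset.sum_congr rfl fun j hj => ?_
  have hij : ⟪(e i : E n), e j⟫_ℝ = 0 := by
    have : i ≠ j := (Finset.mem_Ioi.mp hj).ne
    simp [e, EuclideanSpace.inner_single_left, this]
  have hsw : ιv (e j : E n) * ιv (e i) = -(ιv (e i) * ιv (e j)) := by
    rw [eq_neg_iff_add_eq_zero, add_comm, ι_mul_add_swap, hij]
    simp
  simp only [f]
  rw [← mul_assoc, ← mul_assoc, hsw, mul_sub, mul_smul_comm, mul_smul_comm, neg_mul, smul_neg,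
    sub_eq_add_neg]

/-- The spherical Dirac operator in terms of an orthonormal basis of the tangent space. -/
theorem diracS_eq {ι : Type*} [Fintype ι] (hx : ‖x‖ = 1) (hne : x ≠ eLast n) {g : E n → Cl n}
    (hg : DifferentiableAt ℝ g x) (b : OrthonormalBasis ι ℝ (hyperplane x)) :
    diracS g x = -(∑ l, ιv (b l : E n) * fderiv ℝ g x (b l)) + ((n : ℝ) / 2) • (ιv x * g x) := by
  -- The extension of degree 0 has no radial derivative.
  have hs : ∑ j, x j • spherePartial g x j = 0 := by
    simp only [spherePartial_eq hx hne hg, ← map_smul, ← Submodule.coe_smul]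
    rw [← map_sum, ← Submodule.coe_sum, ← map_sum]
    have h : ∑ j, x j • (e j : E n) = x := by
      have := (EuclideanSpace.basisFun (Fin (n + 1)) ℝ).sum_repr x
      simpa [e] using this
    rw [h, coe_projection_hyperplane hx hne, real_inner_self_eq_norm_sq, hx]
    simp
  rw [diracS, Lam, sum_ι_mul_eq x _ hs]
  simp only [spherePartial_eq hx hne hg]
  have := sum_projection_eq b (vecMul ((fderiv ℝ g x).toLinearMap.comp (hyperplane x).subtype))
  simp only [vecMul_apply, LinearMap.comp_apply, Submodule.subtype_apply,
    ContinuousLinearMap.coe_coe] at this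
  rw [this, mul_add, ← mul_assoc, ι_mul_self, hx, mul_smul_comm]
  simp

end Sphere

/-! ### Derivatives of the weight, the Cayley map and the reflection. -/

section Derivatives

variable {X : Type*} [NormedAddCommGroup X] [InnerProductSpace ℝ X] {y : X}

theorem hasFDerivAt_inv_norm_pow (hy : y ≠ 0) (m : ℕ) :
    HasFDerivAt (fun z : X => (‖z‖ ^ m)⁻¹) (-(m * (‖y‖ ^ (m + 2))⁻¹) • innerSL ℝ y) y := by
  have h0 : ‖y‖ ≠ 0 := norm_ne_zero_iff.mpr hy
  have h1 : HasDerivAt (fun r : ℝ => (r ^ m)⁻¹) (-(m * ‖y‖ ^ (m - 1)) / (‖y‖ ^ m) ^ 2) ‖y‖ :=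
    (hasDerivAt_pow m ‖y‖).fun_inv (pow_ne_zero m h0)
  refine (h1.comp_hasFDerivAt y (hasFDerivAt_norm hy)).congr_fderiv ?_
  rw [smul_smul]
  congr 1
  cases m with
  | zero => simp
  | succ m =>
    rw [Nat.add_sub_cancel]
    field_simp
    ring

variable {n : ℕ} {x : E n}

/-- Conformality of the inversion: the same reflection acts on w and on tangent vectors. -/
theorem hasFDerivAt_inversion {y : E n} (hy : y ≠ 0) :
    HasFDerivAt (fun z : E n => (‖z‖ ^ 2)⁻¹ • z)
      ((‖y‖ ^ 2)⁻¹ • LinearMap.toContinuousLinearMap (twist y)) y := by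
  have h0 : ‖y‖ ≠ 0 := norm_ne_zero_iff.mpr hy
  refine ((hasFDerivAt_inv_norm_pow hy 2).fun_smul (hasFDerivAt_id y)).congr_fderiv ?_
  ext1 v
  change (‖y‖ ^ 2)⁻¹ • v + (-((2 : ℕ) * (‖y‖ ^ (2 + 2))⁻¹) * ⟪y, v⟫_ℝ) • y =
    (‖y‖ ^ 2)⁻¹ • twist y v
  rw [twist_apply hy, smul_sub, sub_eq_add_neg, smul_smul, smul_smul, smul_smul, ← neg_smul]
  congr 2
  push_cast
  field_simp

theorem hasFDerivAt_sub_eLast (x : E n) :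
    HasFDerivAt (fun z : E n => z - eLast n) (ContinuousLinearMap.id ℝ (E n)) x :=
  (hasFDerivAt_id x).sub_const _

theorem hasFDerivAt_J (hne : x ≠ eLast n) :
    HasFDerivAt (J : E n → Cl n)
      ((‖x - eLast n‖ ^ n)⁻¹ • ιCLM n +
        (-(n * (‖x - eLast n‖ ^ (n + 2))⁻¹) • innerSL ℝ (x - eLast n)).smulRight
          (ιv (x - eLast n))) x := by
  have hy : x - eLast n ≠ 0 := sub_ne_zero.mpr hne
  have h := ((hasFDerivAt_inv_norm_pow hy n).fun_smul (ιCLM n).hasFDerivAt)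
  have h' := HasFDerivAt.comp (f := fun z : E n => z - eLast n) x h (hasFDerivAt_sub_eLast x)
  rw [ContinuousLinearMap.comp_id] at h'
  exact h'

theorem hasFDerivAt_inversion_sub (hne : x ≠ eLast n) :
    HasFDerivAt (fun z : E n => (‖z - eLast n‖ ^ 2)⁻¹ • (z - eLast n))
      ((‖x - eLast n‖ ^ 2)⁻¹ • LinearMap.toContinuousLinearMap (twist (x - eLast n))) x := by
  have h := HasFDerivAt.comp (f := fun z : E n => z - eLast n) x
    (hasFDerivAt_inversion (sub_ne_zero.mpr hne)) (hasFDerivAt_sub_eLast x)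
  rw [ContinuousLinearMap.comp_id] at h
  exact h

theorem hasFDerivAt_invCayley (hne : x ≠ eLast n) :
    HasFDerivAt (invCayley : E n → Rn n)
      ((toRn n).comp (-((2 : ℝ) • (‖x - eLast n‖ ^ 2)⁻¹ •
        LinearMap.toContinuousLinearMap (twist (x - eLast n))))) x := by
  have h := (toRn n).hasFDerivAt.comp x
    (((hasFDerivAt_inversion_sub hne).const_smul (2 : ℝ)).const_sub (-eLast n))
  refine h.congr_of_eventuallyEq (Filter.Eventually.of_forall fun z => ?_)
  simp only [invCayley, Function.comp_apply, Pi.smul_apply, smul_smul, div_eq_mul_inv]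

theorem hasFDerivAt_twist_sub (hne : x ≠ eLast n) (w : E n) :
    HasFDerivAt (fun z : E n => twist (z - eLast n) w)
      (-(⟪x - eLast n, w⟫_ℝ • (2 : ℝ) • (‖x - eLast n‖ ^ 2)⁻¹ •
          LinearMap.toContinuousLinearMap (twist (x - eLast n)) +
        (innerSL ℝ w).smulRight ((2 : ℝ) • (‖x - eLast n‖ ^ 2)⁻¹ • (x - eLast n)))) x := by
  have h1 : HasFDerivAt (fun z : E n => ⟪z - eLast n, w⟫_ℝ) (innerSL ℝ w) x := by
    have h := (innerSL ℝ w).hasFDerivAt.comp x (hasFDerivAt_sub_eLast x)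
    refine h.congr_of_eventuallyEq (Filter.Eventually.of_forall fun z => ?_)
    exact real_inner_comm _ _
  have h2 := (h1.fun_smul ((hasFDerivAt_inversion_sub hne).fun_const_smul (2 : ℝ))).const_sub w
  refine h2.congr_of_eventuallyEq ?_
  filter_upwards [isOpen_ne.mem_nhds hne] with z hz
  exact twist_apply (sub_ne_zero.mpr hz) w

end Derivatives

/-! ### Differentiating the pullback on the sphere. -/

section Pullback

variable {n : ℕ} {x : E n} {f : Rn n → Rn n → Cl n}

theorem hasFDerivAt_pullback_snd (hne : x ≠ eLast n) (w : E n)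
    {f' : Rn n × Rn n →L[ℝ] Cl n}
    (hf : HasFDerivAt (fun p : Rn n × Rn n => f p.1 p.2) f'
      (invCayley x, toRn n (twist (x - eLast n) w))) :
    HasFDerivAt (fun z => f (invCayley z) (toRn n (twist (z - eLast n) w)))
      (f'.comp (((toRn n).comp (-((2 : ℝ) • (‖x - eLast n‖ ^ 2)⁻¹ •
        LinearMap.toContinuousLinearMap (twist (x - eLast n))))).prod
        ((toRn n).comp (-(⟪x - eLast n, w⟫_ℝ • (2 : ℝ) • (‖x - eLast n‖ ^ 2)⁻¹ •
          LinearMap.toContinuousLinearMap (twist (x - eLast n)) +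
        (innerSL ℝ w).smulRight ((2 : ℝ) • (‖x - eLast n‖ ^ 2)⁻¹ • (x - eLast n))))))) x :=
  HasFDerivAt.comp (f := fun z => (invCayley z, toRn n (twist (z - eLast n) w))) x hf
    ((hasFDerivAt_invCayley hne).prodMk ((toRn n).hasFDerivAt.comp x (hasFDerivAt_twist_sub hne w)))

theorem differentiableAt_pullback (hne : x ≠ eLast n) (w : E n)
    (hf : DifferentiableAt ℝ (fun p : Rn n × Rn n => f p.1 p.2)
      (invCayley x, toRn n (twist (x - eLast n) w))) :
    DifferentiableAt ℝ (fun z => pullback f z w) x :=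
  differentiableAt_mul (hasFDerivAt_J hne).differentiableAt
    (hasFDerivAt_pullback_snd hne w hf.hasFDerivAt).differentiableAt

/-- The two derivatives in the second variable come from the moving reflection: one from the factor
⟨y, w⟩, the other from the inversion y / ‖y‖². -/
theorem fderiv_pullback (hne : x ≠ eLast n) (w t : hyperplane x)
    (hf : DifferentiableAt ℝ (fun p : Rn n × Rn n => f p.1 p.2) (invCayley x, uOf x w)) :
    fderiv ℝ (fun z => pullback f z w) x t =
      -(2 * (‖x - eLast n‖ ^ 2)⁻¹) • (J x * (fderiv ℝ (fun z => f z (uOf x w)) (invCayley x) (uOf x t) +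
        (⟪(t : E n), w⟫_ℝ • fderiv ℝ (f (invCayley x)) (uOf x w) (toRn n (x - eLast n)) +
          ⟪x - eLast n, w⟫_ℝ • fderiv ℝ (f (invCayley x)) (uOf x w) (uOf x t)))) +
      ((‖x - eLast n‖ ^ n)⁻¹ • ιv (t : E n) -
        (n * (‖x - eLast n‖ ^ (n + 2))⁻¹ * ⟪x - eLast n, t⟫_ℝ) • ιv (x - eLast n)) *
          f (invCayley x) (uOf x w) := by
  set f' := fderiv ℝ (fun p : Rn n × Rn n => f p.1 p.2) (invCayley x, uOf x w) with hf'
  have hw := toRn_twist w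
  have h := hf.hasFDerivAt
  have h1 : HasFDerivAt (fun z => f z (uOf x w))
      (f'.comp (ContinuousLinearMap.inl ℝ (Rn n) (Rn n))) (invCayley x) :=
    HasFDerivAt.comp (f := fun z => (z, uOf x w)) (invCayley x) h (hasFDerivAt_prodMk_left _ _)
  have h2 : HasFDerivAt (f (invCayley x))
      (f'.comp (ContinuousLinearMap.inr ℝ (Rn n) (Rn n))) (uOf x w) :=
    HasFDerivAt.comp (f := fun u => (invCayley x, u)) (uOf x w) h (hasFDerivAt_prodMk_right _ _)
  have h3 := hasFDerivAt_pullback_snd hne (w : E n) (hw ▸ h)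
  have hJ := hasFDerivAt_J hne
  have h4 : fderiv ℝ (fun z => pullback f z w) x t = _ :=
    fderiv_mul_apply hJ.differentiableAt h3.differentiableAt (t : E n)
  rw [h4, h3.fderiv, hJ.fderiv, h1.fderiv, h2.fderiv, hw]
  congr 1
  · rw [← mul_smul_comm]
    congr 1
    simp only [ContinuousLinearMap.comp_apply, ContinuousLinearMap.inl_apply,
      ContinuousLinearMap.inr_apply, ← map_smul, ← map_add]
    congr 1
    ext1
    · simp [toRn_twist, mul_smul]
    · simp [-map_sub, toRn_twist, mul_smul, real_inner_comm (t : E n)]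
      module
  · congr 1
    change (‖x - eLast n‖ ^ n)⁻¹ • ιv (t : E n) + (-(n * (‖x - eLast n‖ ^ (n + 2))⁻¹) *
      ⟪x - eLast n, t⟫_ℝ) • ιv (x - eLast n) = _
    module

end Pullback

/-! ### The intertwining relation. -/

section Intertwining

variable {n : ℕ} {x : E n} {f : Rn n → Rn n → Cl n}

theorem Jm1_eq (x : E n) : Jm1 x = (‖x - eLast n‖ ^ 2)⁻¹ • J x := by
  rw [Jm1, J, smul_smul, ← mul_inv, pow_add, mul_comm]

theorem ι_mul_J (hne : x ≠ eLast n) (w : hyperplane x) :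
    ιv (w : E n) * J x = -(J x * ιv (uEquiv hne w : E n)) := by
  rw [J, mul_smul_comm, ι_mul_ι_twist (sub_ne_zero.mpr hne), smul_neg, smul_mul_assoc]
  rfl

theorem ι_mul_smul_J (hne : x ≠ eLast n) (c : ℝ) (w : hyperplane x) :
    ιv (w : E n) * (c • J x) = -(c • J x * ιv (uEquiv hne w : E n)) := by
  rw [mul_smul_comm, ι_mul_J hne, smul_neg, smul_mul_assoc]

/-- The contribution of the conformal weight to the spherical Dirac operator. -/
theorem sum_mul_fderiv_J {ι : Type*} [Fintype ι] (hx : ‖x‖ = 1) (hne : x ≠ eLast n)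
    (b : OrthonormalBasis ι ℝ (hyperplane x)) (c : Cl n) :
    ∑ l, ιv (b l : E n) * (((‖x - eLast n‖ ^ n)⁻¹ • ιv (b l : E n) -
      (n * (‖x - eLast n‖ ^ (n + 2))⁻¹ * ⟪x - eLast n, b l⟫_ℝ) • ιv (x - eLast n)) * c) =
      ((n : ℝ) / 2) • (ιv x * (J x * c)) := by
  have h0 : ‖x - eLast n‖ ≠ 0 := norm_ne_zero_iff.mpr (sub_ne_zero.mpr hne)
  have h1 := sum_basis_mul_self b c
  -- The tangential part of y. Multiplied by y, its first term cancels Σ b_l² = -n, and its second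
  -- leaves (n/2) x_s J.
  have h2 : ∑ l, ⟪x - eLast n, b l⟫_ℝ • ιv (b l : E n) =
      ιv (x - eLast n) - (‖x - eLast n‖ ^ 2 / 2) • ιv x := by
    have h := congrArg (fun v : hyperplane x => ιv (v : E n))
      (b.orthogonalProjectionOnto_apply_eq_sum (x - eLast n))
    simp only [coe_projection_hyperplane hx hne, inner_sub_eLast hx, Submodule.coe_sum,
      Submodule.coe_smul, ιv, map_sum, map_smul] at h
    rw [map_sub, map_smul] at h
    simp only [real_inner_comm _ (x - eLast n)]
    exact h.symm
  have h3 (l : ι) : ιv (b l : E n) * (((‖x - eLast n‖ ^ n)⁻¹ • ιv (b l : E n) -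
      (n * (‖x - eLast n‖ ^ (n + 2))⁻¹ * ⟪x - eLast n, b l⟫_ℝ) • ιv (x - eLast n)) * c) =
      (‖x - eLast n‖ ^ n)⁻¹ • (ιv (b l : E n) * (ιv (b l : E n) * c)) -
      (n * (‖x - eLast n‖ ^ (n + 2))⁻¹) •
        ((⟪x - eLast n, b l⟫_ℝ • ιv (b l : E n)) * (ιv (x - eLast n) * c)) := by
    rw [sub_mul, smul_mul_assoc, smul_mul_assoc, mul_sub, mul_smul_comm, mul_smul_comm,
      smul_mul_assoc, smul_smul]
  rw [Finset.sum_congr rfl fun l _ => h3 l, Finset.sum_sub_distrib, ← Finset.smul_sum,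
    ← Finset.smul_sum, h1, ← Finset.sum_mul, h2, finrank_hyperplane hne, sub_mul, ← mul_assoc,
    ι_mul_self, ← Algebra.smul_def, J]
  simp only [smul_mul_assoc, mul_smul_comm, smul_sub, smul_smul]
  match_scalars
  · field_simp
    ring
  · field_simp
    ring

/-- The spherical Dirac operator of a pullback is the transform of the Dirac operator, up to a term
in the second summand of the Almansi-Fischer decomposition. -/
theorem diracSX_pullback (hx : ‖x‖ = 1) (hne : x ≠ eLast n)
    (hf : ∀ u, DifferentiableAt ℝ (fun p : Rn n × Rn n => f p.1 p.2) (invCayley x, u))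
    (hD : ∀ u, dirac (f (invCayley x)) u = 0) (w : hyperplane x) :
    diracSX (hyperplane x) (pullback f) x w =
      ((-2 : ℝ) • (‖x - eLast n‖ ^ 2)⁻¹ • J x) * diracX f (invCayley x) (uEquiv hne w) +
      ιv (w : E n) * (((2 : ℝ) • (‖x - eLast n‖ ^ 2)⁻¹ • J x) *
        fderiv ℝ (f (invCayley x)) (uEquiv hne w) (toRn n (x - eLast n))) := by
  let b := stdOrthonormalBasis ℝ (hyperplane x)
  set σ := uEquiv hne
  set z := toRn n (x - eLast n)
  set s := (‖x - eLast n‖ ^ 2)⁻¹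
  set D₁ := fderiv ℝ (fun y => f y (σ w)) (invCayley x)
  set D₂ := fderiv ℝ (f (invCayley x)) (σ w)
  have hu : toRn n (twist (x - eLast n) w) = σ w := toRn_twist w
  have hd : DifferentiableAt ℝ (fun y => pullback f y w) x := by
    refine differentiableAt_pullback hne w ?_
    rw [hu]
    exact hf _
  have h1 : diracX f (invCayley x) (σ w) = ∑ l, ιv (σ (b l) : E n) * D₁ (σ (b l)) :=
    dirac_eq_sum (b.map σ) _ _
  -- Monogenicity of f in u removes the term with coefficient ⟨y, w⟩.
  have h2 : ∑ l, ιv (σ (b l) : E n) * D₂ (σ (b l)) = 0 :=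
    (dirac_eq_sum (b.map σ) _ _).symm.trans (hD _)
  have h3 : ∑ l, ⟪(b l : E n), w⟫_ℝ • ιv (σ (b l) : E n) = ιv (σ w : E n) := by
    have h := congrArg (fun v => ιv (σ v : E n)) (b.sum_repr' w)
    simp only [map_sum, map_smul, Submodule.coe_sum, Submodule.coe_smul, ιv] at h
    exact h
  have h4 (l) : ιv (b l : E n) * fderiv ℝ (fun y => pullback f y w) x (b l) =
      ((2 * s) • J x) * (ιv (σ (b l) : E n) * D₁ (σ (b l))) +
      (((2 * s) • J x) * ((⟪(b l : E n), w⟫_ℝ • ιv (σ (b l) : E n)) * D₂ z) +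
        ((2 * s) • J x) * (⟪x - eLast n, w⟫_ℝ • (ιv (σ (b l) : E n) * D₂ (σ (b l))))) +
      ιv (b l : E n) * (((‖x - eLast n‖ ^ n)⁻¹ • ιv (b l : E n) -
        (n * (‖x - eLast n‖ ^ (n + 2))⁻¹ * ⟪x - eLast n, b l⟫_ℝ) • ιv (x - eLast n)) *
          f (invCayley x) (σ w)) := by
    rw [fderiv_pullback hne w (b l) (hf _), mul_add]
    congr 1
    rw [← smul_mul_assoc, ← mul_assoc, ι_mul_smul_J hne]
    change -(_ * ιv (σ (b l) : E n)) * (D₁ (σ (b l)) + (_ • D₂ z + _ • D₂ (σ (b l)))) = _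
    simp only [neg_smul, neg_mul, neg_neg, mul_add, mul_smul_comm, smul_mul_assoc, mul_assoc]
    abel
  rw [diracSX, diracS_eq hx hne hd b, Finset.sum_congr rfl fun l _ => h4 l]
  simp only [Finset.sum_add_distrib, ← Finset.mul_sum, ← Finset.sum_mul, ← Finset.smul_sum]
  rw [sum_mul_fderiv_J hx hne b, h2, h3, ← h1, pullback, hu]
  have h5 : ιv (w : E n) * (((2 : ℝ) • s • J x) * D₂ z) =
      -(((2 : ℝ) • s • J x) * (ιv (σ w : E n) * D₂ z)) := by
    rw [smul_smul, ← mul_assoc, ι_mul_smul_J hne, neg_mul, mul_assoc]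
  rw [h5]
  simp only [smul_zero, mul_zero, smul_mul_assoc, smul_smul, neg_mul, neg_smul]
  abel

end Intertwining

end RaritaSchwinger

end

open RaritaSchwinger
/-- Intertwining formula, under the inverse Cayley transformation, for the Rarita-Schwinger
operator on `ℝ^n` and the spherical Rarita-Schwinger type operator on `𝕊^n`. -/
theorem theorem3 (n k : ℕ) (U : Set (Rn n)) (hU : IsOpen U)
    (f : Rn n → Rn n → Cl n)
    (hf : DifferentiableOn ℝ
      (fun p : Rn n × Rn n => f p.1 p.2) (U ×ˢ Set.univ))
    (hfk : ∀ x ∈ U, IsMonogenic k (f x))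
    (xs : E n) (hxs : ‖xs‖ = 1) (hne : xs ≠ eLast n)
    (hxU : invCayley xs ∈ U) :
    -- the operators apply: no derivative or projection below is a default value
    (∀ w : E n, DifferentiableAt ℝ
        (fun y : E n => pullback f (‖y‖⁻¹ • y) w) xs) ∧
    IsMonogenic k
      (fun w : hyperplane xs => pullback f xs w) ∧
    IsHarmonic k
      (diracX f (invCayley xs)) ∧
    IsHarmonic k
      (diracSX (hyperplane xs)
        (pullback f) xs) ∧
    IsMonogenicPart k
      (diracX f (invCayley xs))
      (R k f (invCayley xs)) ∧
    IsMonogenicPart k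
      (diracSX (hyperplane xs)
        (pullback f) xs)
      (RS k (hyperplane xs) (pullback f) xs) ∧
    -- the intertwining formula
    ∀ w : hyperplane xs,
      (-2 : ℝ) • (Jm1 xs *
          R k f (invCayley xs) (uOf xs w)) =
        RS k (hyperplane xs)
          (pullback f) xs w := by
  have hd (u : Rn n) :
      DifferentiableAt ℝ (fun p : Rn n × Rn n => f p.1 p.2) (invCayley xs, u) :=
    hf.differentiableAt ((hU.prod isOpen_univ).mem_nhds ⟨hxU, trivial⟩)
  have hM := hfk _ hxU
  have hharm : IsHarmonic k (diracX f (invCayley xs)) := by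
    have h : diracX f (invCayley xs) = fun u => ∑ j, ιv (e j) *
        fderiv ℝ (fun y => f y u) (invCayley xs) ((Rn n).orthogonalProjectionOnto (e j)) := rfl
    rw [h]
    refine isHarmonic_sum_const_mul _ _ fun j =>
      isMonogenic_fderiv_param (hU.mem_nhds hxU) (fun u => ?_) hfk _
    exact DifferentiableAt.comp (f := fun y => (y, u)) (invCayley xs) (hd u)
      (differentiableAt_id.prodMk (differentiableAt_const u))
  have hR : IsMonogenicPart k (diracX f (invCayley xs)) (R k f (invCayley xs)) :=
    hharm.isMonogenicPart_P
  -- An explicit decomposition of D_s F: it yields harmonicity and identifies the projection at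
  -- once.
  have hpart : IsMonogenicPart k (diracSX (hyperplane xs) (pullback f) xs)
      (fun w => ((-2 : ℝ) • (‖xs - eLast n‖ ^ 2)⁻¹ • J xs) *
        R k f (invCayley xs) (uEquiv hne w)) := by
    have hc (c : ℝ) (w : hyperplane xs) :
        ιv (w : E n) * (c • (‖xs - eLast n‖ ^ 2)⁻¹ • J xs) =
          -((c • (‖xs - eLast n‖ ^ 2)⁻¹ • J xs) * ιv (uEquiv hne w : E n)) := by
      rw [smul_smul, ι_mul_smul_J hne]
    rw [show diracSX (hyperplane xs) (pullback f) xs = _ from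
      funext fun w => diracSX_pullback hxs hne hd hM.2 w]
    exact (hR.transport (uEquiv hne) (hc (-2))).add_id_mul
      ((hM.isMonogenicPred_fderiv _).transport (uEquiv hne) (hc 2))
  have hRS : IsMonogenicPart k (diracSX (hyperplane xs) (pullback f) xs)
      (RS k (hyperplane xs) (pullback f) xs) := hpart.isHarmonic.isMonogenicPart_P
  refine ⟨fun w => ?_, ?_, hharm, hpart.isHarmonic, hR, hRS, fun w => ?_⟩
  · have h := differentiableAt_pullback hne w (hd _)
    have h' : DifferentiableAt ℝ (fun z => pullback f z w) (‖xs‖⁻¹ • xs) := by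
      rwa [hxs, inv_one, one_smul]
    exact DifferentiableAt.comp (f := fun y : E n => ‖y‖⁻¹ • y) xs h'
      (hasFDerivAt_normalize hxs).differentiableAt
  · have h := hM.transport (uEquiv hne) (ι_mul_J hne)
    convert h using 2 with w
    rw [pullback, toRn_twist, uEquiv_apply]
  · rw [hRS.unique hpart, Jm1_eq]
    simp only [uEquiv_apply, smul_mul_assoc]
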